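/- Let $\mathfrak g$ be a real Lie algebra and let $\Phi(\mathfrak g)=\mathfrak g\oplus\mathfrak g^*$, equipped with the bracket $$[u+\alpha,v+\beta]=[u,v]+\mathrm{ad}_u^t\beta-\mathrm{ad}_v^t\alpha,\qquad \langle \mathrm{ad}_u^t\alpha,v\rangle=-\langle\alpha,[u,v]\rangle,$$ and the neutral metric $\langle u+\alpha,v+\beta\rangle=\tfrac12(\alpha(v)+\beta(u))$. A generalized complex structure on $\mathfrak g$ is a linear endomorphism $\mathcal J$ of $\Phi(\mathfrak g)$ such that, for all $a,b\in\Phi(\mathfrak g)$, $\mathcal J^2=-\mathrm{Id}$, $\langle\mathcal Ja,b\rangle+\langle\mathcal Jb,a\rangle=0$ and $$[\mathcal Ja,\mathcal Jb]-\mathcal J[\mathcal Ja,b]-\mathcal J[a,\mathcal Jb]+\mathcal J^2[a,b]=0.$$ Its type is $\tfrac12\dim_{\mathbb R}\big(\mathfrak g^*\cap\mathcal J(\mathfrak g^*)\big)$. A generalized Kähler structure on $\mathfrak g$ is a pair $(\mathcal J_1,\mathcal J_2)$ of commuting generalized complex structures such that $G(a,b)=\langle\mathcal J_1\mathcal J_2a,b\rangle$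 is positive definite on $\Phi(\mathfrak g)$. **Theorem.** Let $\mathfrak g$ be a non-abelian real Lie algebra of dimension four. There is no generalized Kähler structure $(\mathcal J_1,\mathcal J_2)$ on $\mathfrak g$ such that both $\mathcal J_1$ and $\mathcal J_2$ are of type $0$. -/

import Mathlib

namespace GenKahler

variable {𝔤 : Type*} [LieRing 𝔤] [LieAlgebra ℝ 𝔤]

/-- The double `Φ(𝔤) = 𝔤 ⊕ 𝔤*`; the pair `(u, α)` stands for `u + α`. -/
abbrev Double (𝔤 : Type*) [LieRing 𝔤] [LieAlgebra ℝ 𝔤] : Type _ :=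
  𝔤 × Module.Dual ℝ 𝔤

/-- `ad_u^t α`, the linear form `v ↦ -⟨α, [u, v]⟩`. -/
def adT (u : 𝔤) (α : Module.Dual ℝ 𝔤) : Module.Dual ℝ 𝔤 :=
  -(α ∘ₗ (LieAlgebra.ad ℝ 𝔤 u : 𝔤 →ₗ[ℝ] 𝔤))

/-- The Courant bracket of left invariant sections:
`[u + α, v + β] = [u, v] + ad_u^t β - ad_v^t α`. -/
def courant (a b : Double 𝔤) : Double 𝔤 :=
  (⁅a.1, b.1⁆, adT a.1 b.2 - adT b.1 a.2)

/-- The neutral metric `⟨u + α, v + β⟩ = (⟨α, v⟩ + ⟨β, u⟩) / 2`. -/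
noncomputable def neutral (a b : Double 𝔤) : ℝ :=
  (1 / 2 : ℝ) * (a.2 b.1 + b.2 a.1)

/-- The Nijenhuis torsion of `K` with respect to the Courant bracket. -/
def nijenhuis (K : Module.End ℝ (Double 𝔤)) (a b : Double 𝔤) : Double 𝔤 :=
  courant (K a) (K b) - K (courant (K a) b) - K (courant a (K b)) + K (K (courant a b))

/-- A generalized complex structure on the Lie algebra `𝔤`. -/
structure IsGeneralizedComplex (K : Module.End ℝ (Double 𝔤)) : Prop where
  sq : ∀ a, K (K a) = -a
  skew : ∀ a b, neutral (K a) b + neutral (K b) a = 0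
  integrable : ∀ a b, nijenhuis K a b = 0

/-- The subspace `𝔤*` of `Φ(𝔤)`. -/
def dualPart (𝔤 : Type*) [LieRing 𝔤] [LieAlgebra ℝ 𝔤] : Submodule ℝ (Double 𝔤) :=
  LinearMap.range (LinearMap.inr ℝ 𝔤 (Module.Dual ℝ 𝔤))

/-- `K` has type `k`: `k` is half the real dimension of `𝔤* ∩ K(𝔤*)`. -/
def HasType (K : Module.End ℝ (Double 𝔤)) (k : ℕ) : Prop :=
  Module.finrank ℝ ↥(dualPart 𝔤 ⊓ (dualPart 𝔤).map K) = 2 * k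

/-- A generalized Kähler structure on `𝔤`: two commuting generalized complex structures
such that `G(a, b) = ⟨K₁ K₂ a, b⟩` is positive definite. -/
structure IsGeneralizedKahler (K₁ K₂ : Module.End ℝ (Double 𝔤)) : Prop where
  fst : IsGeneralizedComplex K₁
  snd : IsGeneralizedComplex K₂
  comm : ∀ a, K₁ (K₂ a) = K₂ (K₁ a)
  pos : ∀ a, a ≠ 0 → 0 < neutral (K₁ (K₂ a)) a

end GenKahler

/-! The involution `K₁ * K₂` splits the double into two eigenspaces, the graphs of `b ± h` over the
Lie algebra, with `h` a metric and `b` skew. On these graphs the structures become `h`-orthogonal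
complex structures `A` and `B` (`exists_bihermitian`), and type 0 for both says that `A - B` and `A
+ B` are injective.

In dimension four this forces `AB + BA = 2s` with `-1 < s < 1` (`exists_anticommutator_eq_smul`), so
`A ± B` have explicit inverses. Integrability then makes the two components of each structure closed
(`isClosedForm`), and linear combinations of them give closed forms for `A`, `B` and `AB - s`.
Orthonormalising `B` against `A` yields a hyperkähler triple.

Finally, a hyperkähler triple in dimension four forces the bracket to vanish
(`isLieAbelian_of_closed_triple`): closedness halves the structure constants, and the totally
antisymmetric part of the Jacobi identity is then a vanishing sum of squares. -/

namespace GenKahler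

/-! ### Pairs of orthogonal complex structures in dimension four. -/

section LinearAlgebra

variable {V : Type*} [AddCommGroup V] [Module ℝ V]

/-- A symmetric operator for a positive definite bilinear form has an eigenvector. -/
theorem exists_eigenvector_of_symmetric [FiniteDimensional ℝ V] [Nontrivial V]
    (h : V →ₗ[ℝ] Module.Dual ℝ V) (hsymm : ∀ x y, h x y = h y x)
    (hpos : ∀ x, x ≠ 0 → 0 < h x x) (S : Module.End ℝ V)
    (hS : ∀ x y, h (S x) y = h x (S y)) :
    ∃ (μ : ℝ) (e : V), e ≠ 0 ∧ S e = μ • e := by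
  let core : InnerProductSpace.Core ℝ V :=
    { inner := fun x y => h x y
      conj_inner_symm := fun x y => by simpa using hsymm y x
      re_inner_nonneg := fun x => by
        by_cases hx : x = 0
        · simp [hx]
        · simpa using (hpos x hx).le
      add_left := fun x y z => by simp
      smul_left := fun x y r => by simp
      definite := fun x hx => by
        by_contra hne
        exact (hpos x hne).ne' hx }
  let _ : NormedAddCommGroup V := core.toNormedAddCommGroup
  let _ : InnerProductSpace ℝ V := InnerProductSpace.ofCore core.toCore
  have hsym : LinearMap.IsSymmetric S := hS
  obtain ⟨e, he⟩ := hsym.hasEigenvalue_iSup_of_finiteDimensional.exists_hasEigenvector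
  exact ⟨_, e, he.2, he.apply_eq_smul⟩

/-- Nonzero pairwise orthogonal vectors, as many as the dimension, form a basis. -/
theorem exists_basis_of_orthogonal (h : V →ₗ[ℝ] Module.Dual ℝ V) (hdim : Module.finrank ℝ V = 4)
    (v : Fin 4 → V) (hne : ∀ i, h (v i) (v i) ≠ 0) (ho : ∀ i j, i ≠ j → h (v i) (v j) = 0) :
    ∃ b : Module.Basis (Fin 4) ℝ V, ∀ i, b i = v i := by
  have hli : LinearIndependent ℝ v :=
    LinearMap.BilinForm.linearIndependent_of_iIsOrtho (B := h) (fun i j hij => ho i j hij) hne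
  exact ⟨basisOfLinearIndependentOfCardEqFinrank hli (by simp [hdim]), fun i => by simp⟩

/-- Expansion of a vector in an orthogonal frame of constant length. -/
theorem smul_eq_sum_of_orthogonal (h : V →ₗ[ℝ] Module.Dual ℝ V) (hdim : Module.finrank ℝ V = 4)
    (v : Fin 4 → V) (l : ℝ) (hl : l ≠ 0) (ho : ∀ i j, h (v i) (v j) = if i = j then l else 0)
    (x : V) : l • x = ∑ k, h x (v k) • v k := by
  obtain ⟨b, hb⟩ := exists_basis_of_orthogonal h hdim v (fun i => by simp [ho, hl])
    (fun i j hij => by simp [ho, hij])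
  have hx := b.sum_repr x
  simp only [hb] at hx
  have hk : ∀ k, h x (v k) = b.repr x k * l := by
    intro k
    conv_lhs => rw [← hx]
    simp [ho]
  simp only [hk]
  conv_lhs => rw [← hx]
  simp only [Finset.smul_sum, smul_smul, mul_comm]

/-- In dimension four, two orthogonal complex structures with invertible sum and difference
have a scalar anticommutator. -/
theorem exists_anticommutator_eq_smul (hdim : Module.finrank ℝ V = 4)
    (h : V →ₗ[ℝ] Module.Dual ℝ V) (hsymm : ∀ x y, h x y = h y x)
    (hpos : ∀ x, x ≠ 0 → 0 < h x x) (A B : Module.End ℝ V)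
    (hA : ∀ x, A (A x) = -x) (hB : ∀ x, B (B x) = -x)
    (hAs : ∀ x y, h (A x) y = -h x (A y)) (hBs : ∀ x y, h (B x) y = -h x (B y))
    (hadd : ∀ x, A x + B x = 0 → x = 0) (hsub : ∀ x, A x - B x = 0 → x = 0) :
    ∃ s : ℝ, 0 < 1 + s ∧ 0 < 1 - s ∧ ∀ x, A (B x) + B (A x) = (2 * s) • x := by
  have : FiniteDimensional ℝ V := Module.finite_of_finrank_pos (by omega)
  have : Nontrivial V := Module.nontrivial_of_finrank_pos (R := ℝ) (by omega)
  -- The anticommutator is symmetric and commutes with `A` and `B`, so the eigenspace of `e` is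
  -- stable under both; it remains to find four independent vectors in it.
  obtain ⟨μ, e, he, hSe⟩ := exists_eigenvector_of_symmetric h hsymm hpos (A * B + B * A)
    (fun x y => by simp [hAs, hBs, add_comm])
  obtain ⟨s, rfl⟩ : ∃ s, μ = 2 * s := ⟨μ / 2, by ring⟩
  simp only [LinearMap.add_apply, Module.End.mul_apply] at hSe
  have hee := hpos e he
  have hAA : h (A e) (A e) = h e e := by rw [hAs, hA]; simp
  have hBB : h (B e) (B e) = h e e := by rw [hBs, hB]; simp
  have hAe : h (A e) e = 0 := by linarith [hAs e e, hsymm (A e) e]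
  have hBe : h (B e) e = 0 := by linarith [hBs e e, hsymm (B e) e]
  have hAB : h (A e) (B e) = -(s * h e e) := by
    have h1 : h e (A (B e) + B (A e)) = h e ((2 * s) • e) := by rw [hSe]
    simp only [map_add, map_smul, smul_eq_mul] at h1
    linarith [hAs e (B e), hBs e (A e), hsymm (A e) (B e)]
  have hBA : h (B e) (A e) = -(s * h e e) := by rw [hsymm, hAB]
  -- The squared lengths of `A e ∓ B e` are `2 * (1 ± s) * h e e`.
  have hs1 : 0 < 1 + s := by
    have := hpos (A e - B e) (fun h0 => he (hsub e h0))
    simp only [map_sub, LinearMap.sub_apply] at this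
    rw [hAA, hBB, hAB, hBA] at this
    by_contra hc
    nlinarith
  have hs2 : 0 < 1 - s := by
    have := hpos (A e + B e) (fun h0 => he (hadd e h0))
    simp only [map_add, LinearMap.add_apply] at this
    rw [hAA, hBB, hAB, hBA] at this
    by_contra hc
    nlinarith
  refine ⟨s, hs1, hs2, ?_⟩
  have hSA : ∀ x, A (B x) + B (A x) = (2 * s) • x →
      A (B (A x)) + B (A (A x)) = (2 * s) • A x := by
    intro x hx
    rw [← map_smul, ← hx, map_add, hA, hA, map_neg, add_comm]
  have hSB : ∀ x, A (B x) + B (A x) = (2 * s) • x →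
      A (B (B x)) + B (A (B x)) = (2 * s) • B x := by
    intro x hx
    rw [← map_smul, ← hx, map_add, hB, hB, map_neg, add_comm]
  -- Gram–Schmidt: the part of `B e` orthogonal to `A e`. The frame `e, A e, f, A f` is then
  -- orthogonal.
  set f : V := B e + s • A e with hf
  have hSf : A (B f) + B (A f) = (2 * s) • f := by
    have h1 := hSA e hSe
    have h2 := hSB e hSe
    have : A (B f) + B (A f) = (A (B (B e)) + B (A (B e))) + s • (A (B (A e)) + B (A (A e))) := by
      simp only [hf, map_add, map_smul]; module
    rw [this, h1, h2, hf]; module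
  have hff : h f f = (1 - s) * (1 + s) * h e e := by
    simp only [hf, map_add, map_smul, LinearMap.add_apply, LinearMap.smul_apply, smul_eq_mul]
    rw [hAA, hBB, hAB, hBA]; ring
  have hfe : h f e = 0 := by
    simp only [hf, map_add, map_smul, LinearMap.add_apply, LinearMap.smul_apply, smul_eq_mul]
    rw [hAe, hBe]; ring
  have hfA : h f (A e) = 0 := by
    simp only [hf, map_add, map_smul, LinearMap.add_apply, LinearMap.smul_apply, smul_eq_mul]
    rw [hAA, hBA]; ring
  have hffp : 0 < h f f := by rw [hff]; positivity
  have hAff : h (A f) (A f) = h f f := by rw [hAs, hA]; simp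
  have hAfe : h (A f) e = 0 := by rw [hAs, hfA, neg_zero]
  have hAfA : h (A f) (A e) = 0 := by rw [hAs, hA]; simp [hfe]
  have hAfB : h (A f) f = 0 := by linarith [hAs f f, hsymm (A f) f]
  obtain ⟨b, hb⟩ := exists_basis_of_orthogonal h hdim ![e, A e, f, A f]
    (fun i => by fin_cases i <;> simp [hAA, hAff, hee.ne', hffp.ne'])
    (fun i j hij => by
      fin_cases i <;> fin_cases j <;> first | exact absurd rfl hij | skip
      all_goals simp [hAe, hfe, hfA, hAfe, hAfA, hAfB, hsymm e, hsymm (A e) f, hsymm (A e) (A f),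
        hsymm f (A f)])
  have key : A * B + B * A = (2 * s) • (1 : Module.End ℝ V) := by
    refine b.ext fun i => ?_
    rw [hb]
    fin_cases i
    · simpa using hSe
    · simpa using hSA e hSe
    · simpa using hSf
    · simpa using hSA f hSf
  intro x
  simpa using LinearMap.congr_fun key x

end LinearAlgebra

/-! ### Hyperkähler triples on four-dimensional Lie algebras. -/

/-- Structure constants satisfying the Jacobi identity vanish if the three fundamental forms of
the standard quaternionic frame are closed. -/
theorem structure_constants_eq_zero (c : Fin 4 → Fin 4 → Fin 4 → ℝ)
    (hc : ∀ i j k, c i j k = -c j i k)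
    (hjac : ∀ i j k l, ∑ m, (c j k m * c i m l + c k i m * c j m l + c i j m * c k m l) = 0)
    (hI : ∀ i j k, c i j (![1, 0, 3, 2] k) * ![1, -1, 1, -1] k
      + c j k (![1, 0, 3, 2] i) * ![1, -1, 1, -1] i
      + c k i (![1, 0, 3, 2] j) * ![1, -1, 1, -1] j = 0)
    (hJ : ∀ i j k, c i j (![2, 3, 0, 1] k) * ![1, -1, -1, 1] k
      + c j k (![2, 3, 0, 1] i) * ![1, -1, -1, 1] i
      + c k i (![2, 3, 0, 1] j) * ![1, -1, -1, 1] j = 0)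
    (hK : ∀ i j k, c i j (![3, 2, 1, 0] k) * ![1, 1, -1, -1] k
      + c j k (![3, 2, 1, 0] i) * ![1, 1, -1, -1] i
      + c k i (![3, 2, 1, 0] j) * ![1, 1, -1, -1] j = 0) :
    ∀ i j k, c i j k = 0 := by
  have hd : ∀ i k, c i i k = 0 := fun i k => by linarith [hc i i k]
  have h10 := hc 1 0
  have h20 := hc 2 0
  have h30 := hc 3 0
  have h21 := hc 2 1
  have h31 := hc 3 1
  have h32 := hc 3 2
  have I1 := hI 0 1 2
  have I2 := hI 0 1 3
  have I3 := hI 0 2 3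
  have I4 := hI 1 2 3
  have J1 := hJ 0 1 2
  have J2 := hJ 0 1 3
  have J3 := hJ 0 2 3
  have J4 := hJ 1 2 3
  have K1 := hK 0 1 2
  have K2 := hK 0 1 3
  have K3 := hK 0 2 3
  have K4 := hK 1 2 3
  have Q1 := hjac 0 1 2 3
  have Q2 := hjac 0 1 3 2
  have Q3 := hjac 0 2 3 1
  have Q4 := hjac 1 2 3 0
  simp [h20, h30, h31] at I1 I2 I3 I4 J1 J2 J3 J4 K1 K2 K3 K4
  simp only [Fin.sum_univ_four, h10, h20, h30, h21, h31, h32, hd] at Q1 Q2 Q3 Q4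
  -- The twelve closedness equations express every remaining constant through the `c 0 j k`.
  have c120 : c 1 2 0 = c 0 1 2 - c 0 2 1 - 2 * c 0 3 0 := by linarith
  have c121 : c 1 2 1 = -c 0 1 3 - c 0 2 0 := by linarith
  have c122 : c 1 2 2 = c 0 1 0 - c 0 2 3 := by linarith
  have c123 : c 1 2 3 = c 0 1 1 + c 0 2 2 := by linarith
  have c130 : c 1 3 0 = c 0 1 3 + 2 * c 0 2 0 - c 0 3 1 := by linarith
  have c131 : c 1 3 1 = c 0 1 2 - c 0 3 0 := by linarith
  have c132 : c 1 3 2 = -c 0 1 1 - c 0 3 3 := by linarith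
  have c133 : c 1 3 3 = c 0 1 0 + c 0 3 2 := by linarith
  have c230 : c 2 3 0 = -2 * c 0 1 0 + c 0 2 3 - c 0 3 2 := by linarith
  have c231 : c 2 3 1 = c 0 2 2 + c 0 3 3 := by linarith
  have c232 : c 2 3 2 = -c 0 2 1 - c 0 3 0 := by linarith
  have c233 : c 2 3 3 = c 0 2 0 - c 0 3 1 := by linarith
  simp only [c120, c121, c122, c123, c130, c131, c132, c133, c230, c231, c232, c233] at Q1 Q2 Q3 Q4
  -- The signs are, up to a global one, those of the permutations 0123, 0132, 0231, 1230: this is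
  -- the Jacobi identity contracted with the volume form.
  have key : c 0 1 0 ^ 2 + c 0 2 0 ^ 2 + c 0 3 0 ^ 2 + c 0 1 1 ^ 2 + c 0 2 2 ^ 2 + c 0 3 3 ^ 2
      + (c 0 2 1 + c 0 3 0) ^ 2 + (c 0 2 0 - c 0 3 1) ^ 2 + (c 0 3 0 - c 0 1 2) ^ 2
      + (c 0 3 2 + c 0 1 0) ^ 2 + (c 0 1 3 + c 0 2 0) ^ 2 + (c 0 1 0 - c 0 2 3) ^ 2 = 0 := by
    linear_combination (-1 / 2) * Q1 + (1 / 2) * Q2 - (1 / 2) * Q3 + (1 / 2) * Q4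
  have sq0 : ∀ x : ℝ, x ^ 2 ≤ 0 → x = 0 := fun x hx =>
    (pow_eq_zero_iff two_ne_zero).1 (le_antisymm hx (sq_nonneg x))
  have s1 := sq_nonneg (c 0 1 0)
  have s2 := sq_nonneg (c 0 2 0)
  have s3 := sq_nonneg (c 0 3 0)
  have s4 := sq_nonneg (c 0 1 1)
  have s5 := sq_nonneg (c 0 2 2)
  have s6 := sq_nonneg (c 0 3 3)
  have s7 := sq_nonneg (c 0 2 1 + c 0 3 0)
  have s8 := sq_nonneg (c 0 2 0 - c 0 3 1)
  have s9 := sq_nonneg (c 0 3 0 - c 0 1 2)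
  have s10 := sq_nonneg (c 0 3 2 + c 0 1 0)
  have s11 := sq_nonneg (c 0 1 3 + c 0 2 0)
  have s12 := sq_nonneg (c 0 1 0 - c 0 2 3)
  have z010 := sq0 (c 0 1 0) (by linarith only [key, s1, s2, s3, s4, s5, s6, s7, s8, s9, s10, s11, s12])
  have z020 := sq0 (c 0 2 0) (by linarith only [key, s1, s2, s3, s4, s5, s6, s7, s8, s9, s10, s11, s12])
  have z030 := sq0 (c 0 3 0) (by linarith only [key, s1, s2, s3, s4, s5, s6, s7, s8, s9, s10, s11, s12])
  have z011 := sq0 (c 0 1 1) (by linarith only [key, s1, s2, s3, s4, s5, s6, s7, s8, s9, s10, s11, s12])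
  have z022 := sq0 (c 0 2 2) (by linarith only [key, s1, s2, s3, s4, s5, s6, s7, s8, s9, s10, s11, s12])
  have z033 := sq0 (c 0 3 3) (by linarith only [key, s1, s2, s3, s4, s5, s6, s7, s8, s9, s10, s11, s12])
  have z021 := sq0 _ (show (c 0 2 1 + c 0 3 0) ^ 2 ≤ 0 by
    linarith only [key, s1, s2, s3, s4, s5, s6, s7, s8, s9, s10, s11, s12])
  have z031 := sq0 _ (show (c 0 2 0 - c 0 3 1) ^ 2 ≤ 0 by
    linarith only [key, s1, s2, s3, s4, s5, s6, s7, s8, s9, s10, s11, s12])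
  have z012 := sq0 _ (show (c 0 3 0 - c 0 1 2) ^ 2 ≤ 0 by
    linarith only [key, s1, s2, s3, s4, s5, s6, s7, s8, s9, s10, s11, s12])
  have z032 := sq0 _ (show (c 0 3 2 + c 0 1 0) ^ 2 ≤ 0 by
    linarith only [key, s1, s2, s3, s4, s5, s6, s7, s8, s9, s10, s11, s12])
  have z013 := sq0 _ (show (c 0 1 3 + c 0 2 0) ^ 2 ≤ 0 by
    linarith only [key, s1, s2, s3, s4, s5, s6, s7, s8, s9, s10, s11, s12])
  have z023 := sq0 _ (show (c 0 1 0 - c 0 2 3) ^ 2 ≤ 0 by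
    linarith only [key, s1, s2, s3, s4, s5, s6, s7, s8, s9, s10, s11, s12])
  rw [z030, add_zero] at z021
  rw [z020, zero_sub, neg_eq_zero] at z031
  rw [z030, zero_sub, neg_eq_zero] at z012
  rw [z010, add_zero] at z032
  rw [z020, add_zero] at z013
  rw [z010, zero_sub, neg_eq_zero] at z023
  simp only [z010, z011, z012, z013, z020, z021, z022, z023, z030, z031, z032, z033, add_zero,
    sub_zero, neg_zero, mul_zero] at c120 c121 c122 c123 c130 c131 c132 c133 c230 c231 c232 c233
  have h0 : ∀ j k, c 0 j k = 0 := by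
    intro j k
    fin_cases j <;> fin_cases k <;> first | exact hd 0 _ | assumption
  have h1 : ∀ k, c 1 2 k = 0 := by intro k; fin_cases k <;> assumption
  have h2 : ∀ k, c 1 3 k = 0 := by intro k; fin_cases k <;> assumption
  have h3 : ∀ k, c 2 3 k = 0 := by intro k; fin_cases k <;> assumption
  intro i j k
  fin_cases i <;> fin_cases j <;> simp [hd, h0, h1, h2, h3, h10, h20, h30, h21, h31, h32]

variable {𝔤 : Type*} [LieRing 𝔤] [LieAlgebra ℝ 𝔤]

/-- The linear map `σ : 𝔤 → 𝔤*`, seen as a bilinear form, satisfies the cocycle identity that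
expresses closedness when `σ` is skew. -/
def IsClosedForm (σ : 𝔤 →ₗ[ℝ] Module.Dual ℝ 𝔤) : Prop :=
  ∀ x y, σ ⁅x, y⁆ = adT x (σ y) - adT y (σ x)

theorem adT_apply (x z : 𝔤) (α : Module.Dual ℝ 𝔤) : adT x α z = -α ⁅x, z⁆ := rfl

theorem adT_add (x : 𝔤) (α β : Module.Dual ℝ 𝔤) : adT x (α + β) = adT x α + adT x β := by
  ext z; simp only [adT_apply, LinearMap.add_apply]; ring

theorem adT_smul (x : 𝔤) (r : ℝ) (α : Module.Dual ℝ 𝔤) : adT x (r • α) = r • adT x α := by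
  ext z; simp only [adT_apply, LinearMap.smul_apply, smul_eq_mul]; ring

theorem IsClosedForm.add {σ τ : 𝔤 →ₗ[ℝ] Module.Dual ℝ 𝔤} (hσ : IsClosedForm σ)
    (hτ : IsClosedForm τ) : IsClosedForm (σ + τ) := fun x y => by
  simp only [LinearMap.add_apply, hσ x y, hτ x y, adT_add]; abel

theorem IsClosedForm.smul {σ : 𝔤 →ₗ[ℝ] Module.Dual ℝ 𝔤} (hσ : IsClosedForm σ) (r : ℝ) :
    IsClosedForm (r • σ) := fun x y => by
  simp only [LinearMap.smul_apply, hσ x y, adT_smul, smul_sub]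

/-- The cyclic form of closedness of the fundamental form of a skew endomorphism. -/
theorem IsClosedForm.cyclic {h : 𝔤 →ₗ[ℝ] Module.Dual ℝ 𝔤} (hsymm : ∀ x y, h x y = h y x)
    {T : Module.End ℝ 𝔤} (hT : ∀ x y, h (T x) y = -h x (T y)) (hcl : IsClosedForm (h ∘ₗ T))
    (x y z : 𝔤) : h ⁅x, y⁆ (T z) + h ⁅y, z⁆ (T x) + h ⁅z, x⁆ (T y) = 0 := by
  have h1 := LinearMap.congr_fun (hcl x y) z
  simp only [LinearMap.comp_apply, LinearMap.sub_apply, adT_apply] at h1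
  rw [hT ⁅x, y⁆, hsymm (T y), hsymm (T x)] at h1
  rw [← lie_skew z x, map_neg, LinearMap.neg_apply]
  linarith

/-- A four-dimensional real Lie algebra with a hyperkähler triple is abelian. -/
theorem isLieAbelian_of_closed_triple (hdim : Module.finrank ℝ 𝔤 = 4)
    (h : 𝔤 →ₗ[ℝ] Module.Dual ℝ 𝔤) (hsymm : ∀ x y, h x y = h y x)
    (hpos : ∀ x, x ≠ 0 → 0 < h x x) (I J : Module.End ℝ 𝔤)
    (hII : ∀ x, I (I x) = -x) (hJJ : ∀ x, J (J x) = -x) (hJI : ∀ x, J (I x) = -I (J x))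
    (hIs : ∀ x y, h (I x) y = -h x (I y)) (hJs : ∀ x y, h (J x) y = -h x (J y))
    (hIc : IsClosedForm (h ∘ₗ I)) (hJc : IsClosedForm (h ∘ₗ J))
    (hKc : IsClosedForm (h ∘ₗ (I * J))) : IsLieAbelian 𝔤 := by
  have : Nontrivial 𝔤 := Module.nontrivial_of_finrank_pos (R := ℝ) (by omega)
  obtain ⟨e, he⟩ := exists_ne (0 : 𝔤)
  have hl := hpos e he
  set l := h e e with hle
  have hKs : ∀ x y, h ((I * J) x) y = -h x ((I * J) y) := fun x y => by
    simp [hIs, hJs, hJI]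
  have hskew : ∀ (T : Module.End ℝ 𝔤), (∀ x y, h (T x) y = -h x (T y)) → ∀ x, h (T x) x = 0 :=
    fun T hT x => by linarith [hT x x, hsymm (T x) x]
  have hIe : h (I e) e = 0 := hskew I hIs e
  have hJe : h (J e) e = 0 := hskew J hJs e
  have hKe : h (I (J e)) e = 0 := hskew (I * J) hKs e
  have hJIe : h (J e) (I e) = 0 := by
    have := hIs (J e) e
    linarith
  have hKIe : h (I (J e)) (I e) = 0 := by rw [hIs, hII]; simp [hJe]
  have hKJe : h (I (J e)) (J e) = 0 := hskew I hIs (J e)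
  have hI2 : h (I e) (I e) = l := by rw [hIs, hII]; simp [hle]
  have hJ2 : h (J e) (J e) = l := by rw [hJs, hJJ]; simp [hle]
  have hK2 : h (I (J e)) (I (J e)) = l := by rw [hIs, hII]; simp [hJ2]
  -- The quaternionic frame is left unnormalised; its common squared length `l` only rescales the
  -- Jacobi identity.
  set v : Fin 4 → 𝔤 := ![e, I e, J e, I (J e)] with hv
  have ho : ∀ i j, h (v i) (v j) = if i = j then l else 0 := by
    intro i j
    fin_cases i <;> fin_cases j <;>
      simp [hv, ← hle, hIe, hJe, hKe, hJIe, hKIe, hKJe, hI2, hJ2, hK2, hsymm e, hsymm (I e) (J e),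
        hsymm (I e) (I (J e)), hsymm (J e) (I (J e))]
  have hexp := smul_eq_sum_of_orthogonal h hdim v l hl.ne' ho
  have hIv : ∀ k, I (v k) = (![1, -1, 1, -1] k : ℝ) • v (![1, 0, 3, 2] k) := by
    intro k; fin_cases k <;> simp [hv, hII]
  have hJv : ∀ k, J (v k) = (![1, -1, -1, 1] k : ℝ) • v (![2, 3, 0, 1] k) := by
    intro k; fin_cases k <;> simp [hv, hJJ, hJI]
  have hKv : ∀ k, (I * J) (v k) = (![1, 1, -1, -1] k : ℝ) • v (![3, 2, 1, 0] k) := by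
    intro k; fin_cases k <;> simp [hv, hJJ, hJI, hII]
  have hzero := structure_constants_eq_zero (fun i j k => h ⁅v i, v j⁆ (v k))
    (fun i j k => by rw [← lie_skew (v i) (v j), map_neg, LinearMap.neg_apply])
    (fun i j k m => by
      have hbr : ∀ i j k, ∑ n, h ⁅v j, v k⁆ (v n) * h ⁅v i, v n⁆ (v m)
          = l * h ⁅v i, ⁅v j, v k⁆⁆ (v m) := by
        intro i j k
        rw [← smul_eq_mul l, ← LinearMap.smul_apply, ← map_smul, ← lie_smul, hexp ⁅v j, v k⁆]
        simp [lie_sum]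
      have hj := congrArg (fun x => h x (v m)) (lie_jacobi (v i) (v j) (v k))
      simp only [map_add, LinearMap.add_apply, map_zero, LinearMap.zero_apply] at hj
      simp only [Finset.sum_add_distrib, hbr]
      linear_combination l * hj)
    (fun i j k => by
      have := hIc.cyclic hsymm hIs (v i) (v j) (v k)
      simp only [hIv, map_smul, smul_eq_mul] at this
      linear_combination this)
    (fun i j k => by
      have := hJc.cyclic hsymm hJs (v i) (v j) (v k)
      simp only [hJv, map_smul, smul_eq_mul] at this
      linear_combination this)
    (fun i j k => by
      have := hKc.cyclic hsymm hKs (v i) (v j) (v k)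
      simp only [hKv, map_smul, smul_eq_mul] at this
      linear_combination this)
  have hbr0 : ∀ i j, ⁅v i, v j⁆ = 0 := by
    intro i j
    have := hexp ⁅v i, v j⁆
    simp only [hzero, zero_smul, Finset.sum_const_zero] at this
    exact (smul_eq_zero.1 this).resolve_left hl.ne'
  refine ⟨fun x y => ?_⟩
  have h0 : ⁅l • x, l • y⁆ = 0 := by
    rw [hexp x, hexp y]
    simp [lie_sum, sum_lie, hbr0]
  simpa [hl.ne'] using h0

end GenKahler


/-! ### Integrability in type 0, and the bihermitian data. -/

namespace GenKahler

variable {𝔤 : Type*} [LieRing 𝔤] [LieAlgebra ℝ 𝔤]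

theorem adT_neg_left (x : 𝔤) (α : Module.Dual ℝ 𝔤) : adT (-x) α = -adT x α := by
  ext z; simp [adT_apply, -lie_skew]

theorem adT_neg (x : 𝔤) (α : Module.Dual ℝ 𝔤) : adT x (-α) = -adT x α := by
  ext z; simp [adT_apply]

theorem adT_zero_left (α : Module.Dual ℝ 𝔤) : adT (0 : 𝔤) α = 0 := by
  ext z; simp [adT_apply]

/-- A generalized complex structure of type `0` maps no nonzero covector to a covector. -/
theorem HasType.eq_zero_of_fst_eq_zero [FiniteDimensional ℝ 𝔤] {K : Module.End ℝ (Double 𝔤)}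
    (ht : HasType K 0) (hsq : ∀ a, K (K a) = -a) {α : Module.Dual ℝ 𝔤}
    (hα : (K (0, α)).1 = 0) : α = 0 := by
  have hbot : dualPart 𝔤 ⊓ (dualPart 𝔤).map K = ⊥ := Submodule.finrank_eq_zero.1 ht
  have hmem : K (0, α) ∈ dualPart 𝔤 ⊓ (dualPart 𝔤).map K :=
    ⟨⟨(K (0, α)).2, Prod.ext hα.symm rfl⟩, ⟨(0, α), ⟨α, rfl⟩, rfl⟩⟩
  rw [hbot, Submodule.mem_bot] at hmem
  have h := hsq (0, α)
  rw [hmem, map_zero] at h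
  simpa using (congrArg Prod.snd h).symm

/-- If `K` sends the covector `T z` to `-(z + B z)`, then integrability of `K` forces both
components `T` and `B` to be closed. -/
theorem IsGeneralizedComplex.isClosedForm {K : Module.End ℝ (Double 𝔤)}
    (hK : IsGeneralizedComplex K) (hinj : ∀ α, (K (0, α)).1 = 0 → α = 0)
    {T B : 𝔤 →ₗ[ℝ] Module.Dual ℝ 𝔤} (hTB : ∀ z, K (0, T z) = -(z, B z)) :
    IsClosedForm T ∧ IsClosedForm B := by
  have key : ∀ x y, K (0, adT x (T y) - adT y (T x))
      = -(⁅x, y⁆, adT x (B y) - adT y (B x)) := by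
    intro x y
    -- Covectors have zero bracket with each other, so the last torsion term drops out.
    have h := hK.integrable (0, T x) (0, T y)
    have e1 : courant (-(x, B x) : Double 𝔤) (-(y, B y))
        = (⁅x, y⁆, adT x (B y) - adT y (B x)) := by
      simp [courant, adT_neg_left, adT_neg]
    have e2 : courant (-(x, B x) : Double 𝔤) (0, T y) = -(0, adT x (T y)) := by
      simp [courant, adT_neg_left, adT_zero_left]
    have e3 : courant ((0, T x) : Double 𝔤) (-(y, B y)) = (0, adT y (T x)) := by
      simp [courant, adT_neg_left, adT_zero_left]
    have e4 : courant ((0, T x) : Double 𝔤) (0, T y) = 0 := by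
      simp [courant, adT_zero_left]
    have e5 : ((0, adT x (T y) - adT y (T x)) : Double 𝔤)
        = (0, adT x (T y)) - (0, adT y (T x)) := by simp
    rw [nijenhuis, hTB, hTB, e1, e2, e3, e4, map_neg, map_zero, map_zero] at h
    rw [e5, map_sub, ← sub_eq_zero, ← h]
    abel
  have hT : IsClosedForm T := by
    intro x y
    have hsub : ((0, T ⁅x, y⁆ - (adT x (T y) - adT y (T x))) : Double 𝔤)
        = (0, T ⁅x, y⁆) - (0, adT x (T y) - adT y (T x)) := by simp
    refine sub_eq_zero.1 (hinj _ ?_)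
    rw [hsub, map_sub, hTB, key]
    simp
  refine ⟨hT, fun x y => ?_⟩
  have h := key x y
  rw [← hT, hTB] at h
  exact neg_injective (congrArg Prod.snd h)

theorem neutral_comm (a b : Double 𝔤) : neutral a b = neutral b a := by
  simp only [neutral]; ring

theorem neutral_add_left (a b c : Double 𝔤) : neutral (a + b) c = neutral a c + neutral b c := by
  simp only [neutral, Prod.fst_add, Prod.snd_add, LinearMap.add_apply, map_add]; ring

theorem neutral_neg_left (a b : Double 𝔤) : neutral (-a) b = -neutral a b := by
  simp only [neutral, Prod.fst_neg, Prod.snd_neg, LinearMap.neg_apply, map_neg]; ring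

theorem neutral_add_right (a b c : Double 𝔤) : neutral a (b + c) = neutral a b + neutral a c := by
  rw [neutral_comm, neutral_add_left, neutral_comm b, neutral_comm c]

theorem neutral_neg_right (a b : Double 𝔤) : neutral a (-b) = -neutral a b := by
  rw [neutral_comm, neutral_neg_left, neutral_comm]

theorem IsGeneralizedComplex.neutral_apply {K : Module.End ℝ (Double 𝔤)}
    (hK : IsGeneralizedComplex K) (a b : Double 𝔤) : neutral (K a) b = -neutral a (K b) := by
  rw [neutral_comm a]; linarith [hK.skew a b]

/-- The bihermitian data of a generalized Kähler structure: a metric `h`, a map `b` and two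
orthogonal complex structures `A`, `A'`, such that `K₁` and `K₂` are given on the graphs of
`b ± h` by `A` and `A'` up to sign. -/
theorem IsGeneralizedKahler.exists_bihermitian [FiniteDimensional ℝ 𝔤]
    {K₁ K₂ : Module.End ℝ (Double 𝔤)} (hK : IsGeneralizedKahler K₁ K₂) :
    ∃ (h b : 𝔤 →ₗ[ℝ] Module.Dual ℝ 𝔤) (A A' : Module.End ℝ 𝔤),
      (∀ x y, h x y = h y x) ∧ (∀ x, x ≠ 0 → 0 < h x x) ∧
      (∀ x, A (A x) = -x) ∧ (∀ x, A' (A' x) = -x) ∧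
      (∀ x y, h (A x) y = -h x (A y)) ∧ (∀ x y, h (A' x) y = -h x (A' y)) ∧
      (∀ x, K₁ (x, b x + h x) = (A x, b (A x) + h (A x))) ∧
      (∀ x, K₁ (x, b x - h x) = (A' x, b (A' x) - h (A' x))) ∧
      (∀ x, K₂ (x, b x + h x) = -(A x, b (A x) + h (A x))) ∧
      (∀ x, K₂ (x, b x - h x) = (A' x, b (A' x) - h (A' x))) := by
  set P : Module.End ℝ (Double 𝔤) := K₁ * K₂ with hP
  have hPa : ∀ a, P a = K₁ (K₂ a) := fun a => rfl
  have hPP : ∀ a, P (P a) = a := fun a => by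
    rw [hPa, hPa, ← hK.comm (K₂ a), hK.snd.sq, map_neg, map_neg, hK.fst.sq, neg_neg]
  have hPK : ∀ a, P (K₁ a) = K₁ (P a) := fun a => by rw [hPa, hPa, ← hK.comm]
  have hPs : ∀ a c, neutral (P a) c = neutral a (P c) := fun a c => by
    rw [hPa, hPa, hK.fst.neutral_apply, hK.snd.neutral_apply, hK.comm, neg_neg]
  -- On covectors `G` is half the pairing with `ρ`, so `ρ` is positive definite and invertible; `h`
  -- is its inverse.
  let ρ : Module.Dual ℝ 𝔤 →ₗ[ℝ] 𝔤 :=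
    LinearMap.fst ℝ 𝔤 (Module.Dual ℝ 𝔤) ∘ₗ P ∘ₗ LinearMap.inr ℝ 𝔤 (Module.Dual ℝ 𝔤)
  have hρ : ∀ α, ρ α = (P (0, α)).1 := fun α => rfl
  have hρpos : ∀ α : Module.Dual ℝ 𝔤, α ≠ 0 → 0 < α (ρ α) := by
    intro α hα
    have := hK.pos (0, α) (by simpa using hα)
    rw [← hPa] at this
    simp only [neutral, map_zero, zero_add] at this
    rw [hρ]; linarith
  have hρinj : ∀ α, ρ α = 0 → α = 0 := by
    intro α h0
    by_contra hα
    have := hρpos α hα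
    rw [h0, map_zero] at this
    exact lt_irrefl _ this
  have hρsymm : ∀ α β : Module.Dual ℝ 𝔤, α (ρ β) = β (ρ α) := by
    intro α β
    have := hPs (0, α) (0, β)
    simp only [neutral, map_zero, zero_add, add_zero] at this
    rw [hρ, hρ]; linarith
  let g : Module.Dual ℝ 𝔤 ≃ₗ[ℝ] 𝔤 := LinearEquiv.ofInjectiveOfFinrankEq ρ
    ((injective_iff_map_eq_zero ρ).2 hρinj) Subspace.dual_finrank_eq
  have hg : ∀ α, g α = ρ α := fun α => rfl
  let h : 𝔤 →ₗ[ℝ] Module.Dual ℝ 𝔤 := g.symm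
  have hρh : ∀ x, ρ (h x) = x := fun x => g.apply_symm_apply x
  let b : 𝔤 →ₗ[ℝ] Module.Dual ℝ 𝔤 :=
    LinearMap.snd ℝ 𝔤 (Module.Dual ℝ 𝔤) ∘ₗ P ∘ₗ LinearMap.inr ℝ 𝔤 (Module.Dual ℝ 𝔤) ∘ₗ h
  have hPh : ∀ x, P (0, h x) = (x, b x) := fun x => Prod.ext (hρh x) rfl
  have hPx : ∀ x, P (x, b x) = (0, h x) := fun x => by rw [← hPh, hPP]
  have hsymm : ∀ x y, h x y = h y x := fun x y => by
    have := hρsymm (h x) (h y)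
    rwa [hρh, hρh] at this
  have hpos : ∀ x, x ≠ 0 → 0 < h x x := fun x hx => by
    have := hρpos (h x) (fun h0 => hx (by rw [← hρh x, h0, map_zero]))
    rwa [hρh] at this
  have splus : ∀ x, ((x, b x + h x) : Double 𝔤) = (x, b x) + (0, h x) := fun x => by simp
  have sminus : ∀ x, ((x, b x - h x) : Double 𝔤) = (x, b x) - (0, h x) := fun x => by simp
  have hPplus : ∀ x, P (x, b x + h x) = (x, b x + h x) := fun x => by
    rw [splus, map_add, hPx, hPh, add_comm]
  have hPminus : ∀ x, P (x, b x - h x) = -(x, b x - h x) := fun x => by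
    rw [sminus, map_sub, hPx, hPh, neg_sub]
  -- Two eigenvectors with the same vector part differ by a covector in the kernel of `ρ`, which is
  -- zero.
  have uplus : ∀ a : Double 𝔤, P a = a → a = (a.1, b a.1 + h a.1) := by
    intro a ha
    have h1 : P (a - (a.1, b a.1 + h a.1)) = a - (a.1, b a.1 + h a.1) := by
      rw [map_sub, ha, hPplus]
    have h2 : a - (a.1, b a.1 + h a.1) = (0, a.2 - (b a.1 + h a.1)) := Prod.ext (by simp) rfl
    rw [h2] at h1
    have h3 := hρinj _ (congrArg Prod.fst h1)
    exact Prod.ext rfl (sub_eq_zero.1 h3)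
  have uminus : ∀ a : Double 𝔤, P a = -a → a = (a.1, b a.1 - h a.1) := by
    intro a ha
    have h1 : P (a - (a.1, b a.1 - h a.1)) = -(a - (a.1, b a.1 - h a.1)) := by
      rw [map_sub, ha, hPminus]; abel
    have h2 : a - (a.1, b a.1 - h a.1) = (0, a.2 - (b a.1 - h a.1)) := Prod.ext (by simp) rfl
    rw [h2] at h1
    have h3 := hρinj _ ((congrArg Prod.fst h1).trans (by simp))
    exact Prod.ext rfl (sub_eq_zero.1 h3)
  let A : Module.End ℝ 𝔤 :=
    LinearMap.fst ℝ 𝔤 (Module.Dual ℝ 𝔤) ∘ₗ K₁ ∘ₗ LinearMap.prod LinearMap.id (b + h)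
  let A' : Module.End ℝ 𝔤 :=
    LinearMap.fst ℝ 𝔤 (Module.Dual ℝ 𝔤) ∘ₗ K₁ ∘ₗ LinearMap.prod LinearMap.id (b - h)
  have hA : ∀ x, K₁ (x, b x + h x) = (A x, b (A x) + h (A x)) := fun x =>
    uplus _ (by rw [hPK, hPplus])
  have hA' : ∀ x, K₁ (x, b x - h x) = (A' x, b (A' x) - h (A' x)) := fun x =>
    uminus _ (by rw [hPK, hPminus, map_neg])
  have hK₂ : ∀ a, K₂ a = -K₁ (P a) := fun a => by rw [hPa, hK.fst.sq, neg_neg]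
  have n0 : ∀ x y, neutral ((0, h x) : Double 𝔤) (0, h y) = 0 := fun x y => by simp [neutral]
  -- This says that `b` is skew: `P` is symmetric and carries these vectors to covectors, which are
  -- isotropic.
  have n1 : ∀ x y, neutral ((x, b x) : Double 𝔤) (y, b y) = 0 := fun x y => by
    rw [← hPh, hPs, hPx, n0]
  have n2 : ∀ x y, neutral ((x, b x) : Double 𝔤) (0, h y) = 1 / 2 * h x y := fun x y => by
    simp [neutral, hsymm x]
  have n3 : ∀ x y, neutral ((0, h x) : Double 𝔤) (y, b y) = 1 / 2 * h x y := fun x y => by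
    rw [neutral_comm, n2, hsymm]
  have nplus : ∀ x y, neutral ((x, b x + h x) : Double 𝔤) (y, b y + h y) = h x y := by
    intro x y
    rw [splus, splus, neutral_add_left, neutral_add_right, neutral_add_right, n0, n1, n2, n3]
    ring
  have nminus : ∀ x y, neutral ((x, b x - h x) : Double 𝔤) (y, b y - h y) = -h x y := by
    intro x y
    rw [sminus, sminus, sub_eq_add_neg, sub_eq_add_neg, neutral_add_left, neutral_add_right,
      neutral_add_right, neutral_neg_left, neutral_neg_right, neutral_neg_right, neutral_neg_left,
      n0, n1, n2, n3]
    ring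
  refine ⟨h, b, A, A', hsymm, hpos, fun x => ?_, fun x => ?_, fun x y => ?_, fun x y => ?_,
    hA, hA', fun x => ?_, fun x => ?_⟩
  · have := hK.fst.sq (x, b x + h x)
    rw [hA, hA] at this
    exact congrArg Prod.fst this
  · have := hK.fst.sq (x, b x - h x)
    rw [hA', hA'] at this
    exact congrArg Prod.fst this
  · have := hK.fst.neutral_apply (x, b x + h x) (y, b y + h y)
    rwa [hA, hA, nplus, nplus] at this
  · have := hK.fst.neutral_apply (x, b x - h x) (y, b y - h y)
    rw [hA', hA', nminus, nminus] at this
    linarith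
  · rw [hK₂, hPplus, hA]
  · rw [hK₂, hPminus, map_neg, hA', neg_neg]

end GenKahler

/-! ### From the bihermitian data to a hyperkähler triple. -/

theorem theorem4p2 {𝔤 : Type*} [LieRing 𝔤] [LieAlgebra ℝ 𝔤]
    (hdim : Module.finrank ℝ 𝔤 = 4) (hna : ¬ IsLieAbelian 𝔤) :
    ¬ ∃ K₁ K₂ : Module.End ℝ (GenKahler.Double 𝔤),
      GenKahler.IsGeneralizedKahler K₁ K₂ ∧
        GenKahler.HasType K₁ 0 ∧ GenKahler.HasType K₂ 0 := by
  open GenKahler in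
  rintro ⟨K₁, K₂, hK, ht₁, ht₂⟩
  have : FiniteDimensional ℝ 𝔤 := Module.finite_of_finrank_pos (by omega)
  have hinj₁ : ∀ α, (K₁ (0, α)).1 = 0 → α = 0 := fun α => ht₁.eq_zero_of_fst_eq_zero hK.fst.sq
  have hinj₂ : ∀ α, (K₂ (0, α)).1 = 0 → α = 0 := fun α => ht₂.eq_zero_of_fst_eq_zero hK.snd.sq
  obtain ⟨h, b, A, B, hsymm, hpos, hAA, hBB, hAs, hBs, hA₁, hB₁, hA₂, hB₂⟩ := hK.exists_bihermitian
  have hinjh : ∀ x, h x = 0 → x = 0 := by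
    intro x h0
    by_contra hx
    have := hpos x hx
    simp [h0] at this
  have hdiff : ∀ x, ((0, (2 : ℝ) • h x) : Double 𝔤) = (x, b x + h x) - (x, b x - h x) := fun x => by
    rw [Prod.mk_sub_mk, sub_self]; congr 1; module
  have hcov₁ : ∀ x, K₁ (0, (2 : ℝ) • h x) = (A x - B x, b (A x - B x) + h (A x + B x)) := fun x => by
    rw [hdiff, map_sub, hA₁, hB₁, Prod.mk_sub_mk, map_sub, map_add]; congr 1; abel
  have hcov₂ : ∀ x, K₂ (0, (2 : ℝ) • h x) = -(A x + B x, b (A x + B x) + h (A x - B x)) := fun x => by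
    rw [hdiff, map_sub, hA₂, hB₂, map_sub, map_add, Prod.neg_mk, Prod.neg_mk, Prod.mk_sub_mk]
    congr 1 <;> abel
  have hsub : ∀ x, A x - B x = 0 → x = 0 := fun x hx => by
    have := hinj₁ ((2 : ℝ) • h x) (by rw [hcov₁]; exact hx)
    exact hinjh x ((smul_eq_zero.1 this).resolve_left two_ne_zero)
  have hadd : ∀ x, A x + B x = 0 → x = 0 := fun x hx => by
    have := hinj₂ ((2 : ℝ) • h x) (by rw [hcov₂]; simp [hx])
    exact hinjh x ((smul_eq_zero.1 this).resolve_left two_ne_zero)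
  obtain ⟨s, hs1, hs2, hs⟩ :=
    exists_anticommutator_eq_smul hdim h hsymm hpos A B hAA hBB hAs hBs hadd hsub
  have hBA : ∀ x, B (A x) = (2 * s) • x - A (B x) := fun x => by rw [← hs x]; abel
  have hsne₁ : 1 + s ≠ 0 := hs1.ne'
  have hsne₂ : 1 - s ≠ 0 := hs2.ne'
  -- Since `(A - B)² = -2 (1 + s)`, the equation `(A - B) x = -z` has the solution `x = (A - B) z /
  -- (2 (1 + s))`, and `T z` is `2 h x`.
  obtain ⟨hT₁, hB₁⟩ := hK.fst.isClosedForm hinj₁ (T := (1 / (1 + s)) • (h ∘ₗ (A - B)))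
    (B := b + (1 / (1 + s)) • (h ∘ₗ (A * B - s • 1))) (fun z => by
      have e1 : ((1 / (1 + s)) • (h ∘ₗ (A - B))) z
          = (2 : ℝ) • h ((1 / (2 * (1 + s))) • (A z - B z)) := by
        simp only [LinearMap.smul_apply, LinearMap.comp_apply, LinearMap.sub_apply, map_smul,
          smul_smul]
        congr 1; field_simp
      have e2 : A ((1 / (2 * (1 + s))) • (A z - B z)) - B ((1 / (2 * (1 + s))) • (A z - B z))
          = -z := by
        simp only [map_smul, map_sub, hAA, hBB, hBA]
        match_scalars <;> field_simp <;> ring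
      have e3 : A ((1 / (2 * (1 + s))) • (A z - B z)) + B ((1 / (2 * (1 + s))) • (A z - B z))
          = -((1 / (1 + s)) • (A (B z) - s • z)) := by
        simp only [map_smul, map_sub, hAA, hBB, hBA]
        match_scalars <;> field_simp <;> ring
      rw [e1, hcov₁, e2, e3]
      refine Prod.ext rfl ?_
      simp only [map_neg, map_smul, Prod.snd_neg, LinearMap.add_apply, LinearMap.smul_apply,
        LinearMap.comp_apply, LinearMap.sub_apply, Module.End.mul_apply, Module.End.one_apply]
      abel)
  -- Likewise `(A + B)² = -2 (1 - s)`, now solving `(A + B) x = z`.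
  obtain ⟨hT₂, hB₂⟩ := hK.snd.isClosedForm hinj₂ (T := (-(1 / (1 - s))) • (h ∘ₗ (A + B)))
    (B := b + (-(1 / (1 - s))) • (h ∘ₗ (A * B - s • 1))) (fun z => by
      have e1 : ((-(1 / (1 - s))) • (h ∘ₗ (A + B))) z
          = (2 : ℝ) • h ((-(1 / (2 * (1 - s)))) • (A z + B z)) := by
        simp only [LinearMap.smul_apply, LinearMap.comp_apply, LinearMap.add_apply, map_smul,
          smul_smul]
        congr 1; field_simp
      have e2 : A ((-(1 / (2 * (1 - s)))) • (A z + B z)) + B ((-(1 / (2 * (1 - s)))) • (A z + B z))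
          = z := by
        simp only [map_smul, map_add, hAA, hBB, hBA]
        match_scalars <;> field_simp <;> ring
      have e3 : A ((-(1 / (2 * (1 - s)))) • (A z + B z)) - B ((-(1 / (2 * (1 - s)))) • (A z + B z))
          = (-(1 / (1 - s))) • (A (B z) - s • z) := by
        simp only [map_smul, map_add, hAA, hBB, hBA]
        match_scalars <;> field_simp <;> ring
      rw [e1, hcov₂, e2, e3, map_smul]
      rfl)
  have hAc : IsClosedForm (h ∘ₗ A) := by
    convert (hT₁.smul ((1 + s) / 2)).add (hT₂.smul (-((1 - s) / 2))) using 1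
    rw [LinearMap.comp_sub, LinearMap.comp_add]
    match_scalars <;> field_simp <;> ring
  have hBc : IsClosedForm (h ∘ₗ B) := by
    convert (hT₁.smul (-((1 + s) / 2))).add (hT₂.smul (-((1 - s) / 2))) using 1
    rw [LinearMap.comp_sub, LinearMap.comp_add]
    match_scalars <;> field_simp <;> ring
  -- Subtracting the two second components cancels `b`.
  have hDc : IsClosedForm (h ∘ₗ (A * B - s • 1)) := by
    convert (hB₁.smul ((1 - s) * (1 + s) / 2)).add (hB₂.smul (-((1 - s) * (1 + s) / 2))) using 1
    match_scalars <;> field_simp <;> ring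
  -- `B + s A` anticommutes with `A` and squares to `-(1 - s²)`, so `r` normalises it.
  obtain ⟨r, hr, hrr⟩ : ∃ r : ℝ, r ≠ 0 ∧ r * r = (1 - s) * (1 + s) :=
    ⟨√((1 - s) * (1 + s)), (Real.sqrt_pos.2 (mul_pos hs2 hs1)).ne',
      Real.mul_self_sqrt (mul_pos hs2 hs1).le⟩
  refine hna (isLieAbelian_of_closed_triple hdim h hsymm hpos A (r⁻¹ • (B + s • A)) hAA
    (fun x => ?_) (fun x => ?_) hAs (fun x y => ?_) hAc ?_ ?_)
  · have hx : (r * r) • (r⁻¹ • (B + s • A)) ((r⁻¹ • (B + s • A)) x) = (r * r) • -x := by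
      rw [hrr]
      simp only [LinearMap.smul_apply, LinearMap.add_apply, map_smul, map_add, hAA, hBB, hBA]
      rw [← hrr]
      match_scalars
      · field_simp
        linear_combination hrr
      · field_simp
        ring
    exact smul_right_injective 𝔤 (mul_ne_zero hr hr) hx
  · simp only [LinearMap.smul_apply, LinearMap.add_apply, map_smul, map_add, hAA, hBA]
    match_scalars <;> ring
  · simp only [LinearMap.smul_apply, LinearMap.add_apply, map_smul, map_add, hAs, hBs, smul_eq_mul]
    ring
  · rw [LinearMap.comp_smul, LinearMap.comp_add, LinearMap.comp_smul]
    exact (hBc.add (hAc.smul s)).smul _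
  · have : A * (r⁻¹ • (B + s • A)) = r⁻¹ • (A * B - s • 1) := by
      ext x
      simp only [Module.End.mul_apply, LinearMap.smul_apply, LinearMap.add_apply, map_smul, map_add,
        hAA, LinearMap.sub_apply, Module.End.one_apply]
      module
    rw [this, LinearMap.comp_smul]
    exact hDc.smul _
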